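/- Let $V$ be a finite linearly ordered set with $n$ elements, and let $X$ be a simplicial complex on $V$, that is, a collection of subsets of $V$ closed under taking subsets (the empty set counts as a simplex of dimension $-1$; elements of $V$ need not be faces; the void collection is allowed). Let $X(k)$ be the set of faces with $k+1$ elements and $f_k(X)=|X(k)|$. Let $\omega\colon V\to\mathbb{R}_{>0}$, and put $\omega(\sigma)=\prod_{v\in\sigma}\omega(v)$ for $\sigma\subseteq V$, with $\omega(\emptyset)=1$. Let $C^k(X)$ be the real vector space of functions on $X(k)$ with the inner product $\langle f,g\rangle=\sum_{\sigma\in X(k)}\omega(\sigma)f(\sigma)g(\sigma)$, let $d_k\colon C^k(X)\to C^{k+1}(X)$ be the coboundary map $(d_k\varphi)(\{v_0<\dots<v_{k+1}\})=\sum_{j=0}^{k+1}(-1)^j\varphi(\{v_0,\dots,\hat v_j,\dots,v_{k+1}\})$, let $d_k^{*}$ be its adjoint with respect to these inner products, and let $L_k^{\omega}(X)=d_k^{*}d_k+d_{k-1}d_{k-1}^{*}$ be the vertex-weighted Laplacian on $C^k(X)$. Write $\operatorname{m}_{L}(\lambda)$ for the multiplicity of $\lambda$ as an eigenvalue of $L$,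 which is $0$ if $\lambda$ is not an eigenvalue. Let $X^{\vee}=\{V\setminus\sigma:\sigma\subseteq V,\ \sigma\notin X\}$ be the Alexander dual of $X$. Then for every integer $k$ with $-1\le k\le n-2$: for every real $\lambda<\sum_{v\in V}\omega(v)$, $$\operatorname{m}_{L_k^{\omega}(X)}(\lambda)=\operatorname{m}_{L_{n-k-3}^{\omega}(X^{\vee})}(\lambda),$$ and for $\lambda=\sum_{v\in V}\omega(v)$, $$\operatorname{m}_{L_k^{\omega}(X)}(\lambda)-\operatorname{m}_{L_{n-k-3}^{\omega}(X^{\vee})}(\lambda)=f_k(X)+f_{k+1}(X)-\binom{n}{k+2}.$$ -/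

import Mathlib

open scoped BigOperators

namespace WeightedComplex

/-- An abstract simplicial complex on the finite vertex set `V`: a collection of subsets of `V`
closed under taking subsets. The empty simplex is a possible face; it belongs to every complex
except the void one. A vertex `v` of `V` need not be a face. -/
abbrev Complex (V : Type*) := LowerSet (Finset V)

variable {V : Type*}

/-- `X(k)`: the simplices of dimension `k`, that is, with `k + 1` elements. -/
noncomputable def faces [Fintype V] (X : Complex V) (k : ℤ) : Finset (Finset V) :=
  open Classical in Finset.univ.filter fun σ => σ ∈ X ∧ (σ.card : ℤ) = k + 1

/-- The number `f_k(X)` of `k`-simplices of `X`. -/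
noncomputable def fNum [Fintype V] (X : Complex V) (k : ℤ) : ℕ := (faces X k).card

/-- The canonical Alexander dual `{V \ σ : σ ∉ X}`. -/
def alexanderDual [Fintype V] [DecidableEq V] (X : Complex V) : Complex V where
  carrier := {τ | τᶜ ∉ X}
  lower' := fun _ _ hba ha hb => ha (X.lower (Finset.compl_subset_compl.mpr hba) hb)

theorem mem_alexanderDual [Fintype V] [DecidableEq V] (X : Complex V) (τ : Finset V) :
    τ ∈ alexanderDual X ↔ ∃ σ : Finset V, σ ∉ X ∧ τ = σᶜ := by
  constructor
  · intro h
    exact ⟨τᶜ, h, (compl_compl τ).symm⟩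
  · rintro ⟨σ, h, rfl⟩
    show σᶜᶜ ∉ X
    rwa [compl_compl]

/-- Real `k`-cochains, in coordinates with respect to the elementary cochains `e_σ`, `σ ∈ X(k)`;
every simplex is oriented by the fixed linear order of `V`. -/
abbrev Cochain [Fintype V] (X : Complex V) (k : ℤ) := faces X k → ℝ

/-- The incidence number of `τ` in `σ`: it is `(-1) ^ j` if `τ` arises from `σ` by deleting the
vertex `v` of `σ` that has exactly `j` vertices of `σ` below it, and `0` if `τ` is not of this
form. -/
def incidence [LinearOrder V] (σ τ : Finset V) : ℝ :=
  ∑ v ∈ σ, if τ = σ.erase v then (-1 : ℝ) ^ (σ.filter (· < v)).card else 0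

/-- The coboundary map from `j`-cochains to `k`-cochains (used for `k = j + 1`, and
zero otherwise). -/
noncomputable def coboundary [Fintype V] [LinearOrder V] (X : Complex V) (j k : ℤ) :
    Cochain X j →ₗ[ℝ] Cochain X k :=
  (Matrix.of fun (σ : faces X k) (τ : faces X j) => incidence σ.1 τ.1).mulVecLin

/-- The inner product on `k`-cochains for which the elementary cochains are orthogonal and
`⟨e_σ, e_σ⟩ = w σ`. -/
noncomputable def cochainInner [Fintype V] (w : Finset V → ℝ) (X : Complex V) (k : ℤ)
    (f g : Cochain X k) : ℝ :=
  ∑ σ : faces X k, w σ.1 * f σ * g σ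

/-- The adjoint of the coboundary map with respect to the weighted inner products; see
`eq_coboundaryAdjoint_iff`. -/
noncomputable def coboundaryAdjoint [Fintype V] [LinearOrder V] (w : Finset V → ℝ)
    (X : Complex V) (j k : ℤ) : Cochain X k →ₗ[ℝ] Cochain X j :=
  (Matrix.of fun (τ : faces X j) (σ : faces X k) =>
    w σ.1 / w τ.1 * incidence σ.1 τ.1).mulVecLin

/-- The usual formula for the coboundary map: `(d φ)(σ) = ∑ (-1) ^ j φ(σ_j)`. -/
theorem coboundary_apply [Fintype V] [LinearOrder V] (X : Complex V) (k : ℤ)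
    (φ : Cochain X k) (σ : faces X (k + 1)) :
    coboundary X k (k + 1) φ σ = ∑ v ∈ σ.1.attach,
      (-1 : ℝ) ^ (σ.1.filter (· < v.1)).card * φ ⟨σ.1.erase v.1, by
        have h := σ.2
        simp only [faces, Finset.mem_filter, Finset.mem_univ, true_and] at h ⊢
        refine ⟨X.lower (Finset.erase_subset _ _) h.1, ?_⟩
        have := Finset.card_erase_add_one v.2
        omega⟩ := by
  simp only [coboundary, Matrix.mulVecLin_apply, Matrix.mulVec, dotProduct, Matrix.of_apply,
    incidence, Finset.sum_mul]
  rw [Finset.sum_comm, ← Finset.sum_attach]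
  refine Finset.sum_congr rfl fun v _ => ?_
  rw [Finset.sum_eq_single_of_mem _ (Finset.mem_univ _)]
  · rw [if_pos]
    rfl
  · intro b _ hb
    rw [if_neg, zero_mul]
    intro h
    exact hb (Subtype.ext h)

/-- For positive weights, `coboundaryAdjoint` is the unique linear map that satisfies the adjoint
relation. -/
theorem eq_coboundaryAdjoint_iff [Fintype V] [LinearOrder V] (w : Finset V → ℝ)
    (hw : ∀ σ, 0 < w σ) (X : Complex V) (j k : ℤ) (g : Cochain X k →ₗ[ℝ] Cochain X j) :
    g = coboundaryAdjoint w X j k ↔ ∀ (f₁ : Cochain X j) (f₂ : Cochain X k),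
      cochainInner w X k (coboundary X j k f₁) f₂ = cochainInner w X j f₁ (g f₂) := by
  have key : ∀ (f₁ : Cochain X j) (f₂ : Cochain X k),
      cochainInner w X k (coboundary X j k f₁) f₂ =
        cochainInner w X j f₁ (coboundaryAdjoint w X j k f₂) := by
    intro f₁ f₂
    simp only [cochainInner, coboundary, coboundaryAdjoint, Matrix.mulVecLin_apply,
      Matrix.mulVec, dotProduct, Matrix.of_apply, Finset.mul_sum, Finset.sum_mul]
    rw [Finset.sum_comm]
    refine Finset.sum_congr rfl fun τ _ => Finset.sum_congr rfl fun σ _ => ?_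
    have := (hw τ.1).ne'
    field_simp
  constructor
  · rintro rfl
    exact key
  · intro h
    refine LinearMap.ext fun f₂ => funext fun τ => ?_
    have h1 := (h (Pi.single τ 1) f₂).symm.trans (key (Pi.single τ 1) f₂)
    simp only [cochainInner, Pi.single_apply, mul_ite, mul_one, mul_zero, ite_mul, zero_mul,
      Finset.sum_ite_eq', Finset.mem_univ, if_true] at h1
    exact mul_left_cancel₀ (hw τ.1).ne' h1

/-- The weighted `k`-dimensional Laplacian `d_k^* d_k + d_{k-1} d_{k-1}^*` on `k`-cochains. -/
noncomputable def laplacian [Fintype V] [LinearOrder V] (w : Finset V → ℝ) (X : Complex V)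
    (k : ℤ) : Module.End ℝ (Cochain X k) :=
  coboundaryAdjoint w X k (k + 1) ∘ₗ coboundary X k (k + 1) +
    coboundary X (k - 1) k ∘ₗ coboundaryAdjoint w X (k - 1) k

/-- The simplex weights given by vertex weights: `ω(σ) = ∏_{v ∈ σ} ω(v)`, and `ω(∅) = 1`. -/
def vertexWeight (ω : V → ℝ) (σ : Finset V) : ℝ := ∏ v ∈ σ, ω v

/-- The multiplicity of `t` as an eigenvalue of the vertex-weighted Laplacian (an operator
that is self-adjoint for the weighted inner product): the dimension of the eigenspace, which
is `0` when `t` is not an eigenvalue. -/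
noncomputable def multiplicity [Fintype V] [LinearOrder V] (ω : V → ℝ) (X : Complex V) (k : ℤ)
    (t : ℝ) : ℕ :=
  Module.finrank ℝ (Module.End.eigenspace (laplacian (vertexWeight ω) X k) t)

end WeightedComplex

/-! Put c = ∑ v, ω v and work in the orthonormal bases e_σ / √ω(σ). On the full simplex the
Laplacian is the scalar c (`sum_normalizedIncidence_mul`). Passing to `X` leaves the down part d d*
on `X(k)` unchanged, since subsets of faces are faces, while the up part d* d loses exactly the
cofaces outside `X`. Hence L_k(X) is conjugate to c - MᵀM, where M = `exitMatrix` goes from k-faces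
to (k+1)-nonfaces (`multiplicity_eq_finrank_gram`). Complementation exchanges nonfaces of `X` with
faces of the dual and reverses inclusions. It changes normalized incidence numbers only by signs
that split into a factor for each simplex, so the exit matrix of the dual is Mᵀ up to diagonal
signs, and its Laplacian is conjugate to c - MMᵀ (`multiplicity_alexanderDual_eq_finrank_gram`). MᵀM
and MMᵀ have the same nonzero spectrum, which settles λ < c. At λ = c both kernels appear; having
equal ranks, they differ in dimension by the number of columns minus the number of rows of M. -/

namespace WeightedComplex

open Module

/-! ### Spectra of products and Gram matrices -/

section LinearAlgebra

/-- For `μ ≠ 0` the operators `g ∘ f` and `f ∘ g` have `μ`-eigenspaces of the same dimension. -/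
theorem finrank_eigenspace_comp_le {E F : Type*} [AddCommGroup E] [Module ℝ E]
    [AddCommGroup F] [Module ℝ F] [FiniteDimensional ℝ F]
    (f : E →ₗ[ℝ] F) (g : F →ₗ[ℝ] E) {μ : ℝ} (hμ : μ ≠ 0) :
    finrank ℝ (End.eigenspace (g ∘ₗ f) μ) ≤ finrank ℝ (End.eigenspace (f ∘ₗ g) μ) := by
  have hmaps : ∀ x ∈ End.eigenspace (g ∘ₗ f) μ, f x ∈ End.eigenspace (f ∘ₗ g) μ := by
    intro x hx
    rw [End.mem_eigenspace_iff] at hx ⊢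
    have : g (f x) = μ • x := hx
    rw [LinearMap.comp_apply, this, map_smul]
  -- On this eigenspace `g ∘ f` is multiplication by `μ ≠ 0`, so `f` is injective there.
  refine LinearMap.finrank_le_finrank_of_injective (f := f.restrict hmaps) ?_
  rw [← LinearMap.ker_eq_bot, LinearMap.ker_eq_bot']
  rintro ⟨x, hx⟩ h
  have hfx : f x = 0 := congrArg Subtype.val h
  have hx' : g (f x) = μ • x := End.mem_eigenspace_iff.mp hx
  rw [hfx, map_zero] at hx'
  exact Subtype.ext ((smul_eq_zero.mp hx'.symm).resolve_left hμ)

theorem finrank_eigenspace_comp_comm {E F : Type*} [AddCommGroup E] [Module ℝ E]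
    [FiniteDimensional ℝ E] [AddCommGroup F] [Module ℝ F] [FiniteDimensional ℝ F]
    (f : E →ₗ[ℝ] F) (g : F →ₗ[ℝ] E) {μ : ℝ} (hμ : μ ≠ 0) :
    finrank ℝ (End.eigenspace (g ∘ₗ f) μ) = finrank ℝ (End.eigenspace (f ∘ₗ g) μ) :=
  le_antisymm (finrank_eigenspace_comp_le f g hμ) (finrank_eigenspace_comp_le g f hμ)

/-- The dimensions of the kernels of `MᵀM` and `MMᵀ` differ by the difference of the sizes. -/
theorem finrank_eigenspace_zero_gram {a b : Type*} [Fintype a] [Fintype b]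
    [DecidableEq a] [DecidableEq b] (M : Matrix b a ℝ) :
    finrank ℝ (End.eigenspace (M.transpose * M).mulVecLin 0) + Fintype.card b =
      finrank ℝ (End.eigenspace (M * M.transpose).mulVecLin 0) + Fintype.card a := by
  have h1 := (M.transpose * M).mulVecLin.finrank_range_add_finrank_ker
  have h2 := (M * M.transpose).mulVecLin.finrank_range_add_finrank_ker
  have h3 : finrank ℝ (LinearMap.range (M.transpose * M).mulVecLin) = M.rank :=
    Matrix.rank_transpose_mul_self M
  have h4 : finrank ℝ (LinearMap.range (M * M.transpose).mulVecLin) = M.rank :=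
    Matrix.rank_self_mul_transpose M
  rw [End.eigenspace_zero, End.eigenspace_zero]
  rw [finrank_fintype_fun_eq_card] at h1 h2
  omega

/-- Matrices that agree up to reindexing and conjugation by an invertible diagonal matrix have
eigenspaces of the same dimensions. -/
theorem finrank_eigenspace_mulVecLin_congr {a b : Type*} [Fintype a] [Fintype b]
    (G : Matrix a a ℝ) (H : Matrix b b ℝ) (e : b ≃ a) (p : b → ℝ) (hp : ∀ i, p i ≠ 0)
    (h : ∀ i j, p i * G (e i) (e j) = H i j * p j) (μ : ℝ) :
    finrank ℝ (End.eigenspace G.mulVecLin μ) = finrank ℝ (End.eigenspace H.mulVecLin μ) := by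
  let φ : (a → ℝ) ≃ₗ[ℝ] (b → ℝ) :=
    (LinearEquiv.funCongrLeft ℝ ℝ e).trans
      (LinearEquiv.piCongrRight fun i => LinearEquiv.smulOfNeZero ℝ ℝ (p i) (hp i))
  have hφ : ∀ x i, φ x i = p i * x (e i) := fun _ _ => rfl
  have hcomm : ∀ x, H.mulVecLin (φ x) = φ (G.mulVecLin x) := by
    intro x
    funext i
    rw [hφ]
    simp only [Matrix.mulVecLin_apply, Matrix.mulVec, dotProduct, hφ]
    rw [← e.sum_comp, Finset.mul_sum]
    refine Finset.sum_congr rfl fun j _ => ?_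
    rw [← mul_assoc, ← mul_assoc, h]
  have hmap : (End.eigenspace G.mulVecLin μ).map φ.toLinearMap
      = End.eigenspace H.mulVecLin μ := by
    ext y
    obtain ⟨x, rfl⟩ := φ.surjective y
    rw [End.mem_eigenspace_iff, hcomm, ← map_smul, φ.injective.eq_iff, ← End.mem_eigenspace_iff]
    exact φ.injective.mem_set_image (s := (End.eigenspace G.mulVecLin μ : Set (a → ℝ)))
  rw [← hmap]
  exact (φ.finrank_map_eq _).symm

theorem eigenspace_mulVecLin_scalar_sub {a : Type*} [Fintype a] [DecidableEq a]
    (G : Matrix a a ℝ) (c t : ℝ) :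
    End.eigenspace (c • (1 : Matrix a a ℝ) - G).mulVecLin t
      = End.eigenspace G.mulVecLin (c - t) := by
  ext x
  simp only [End.mem_eigenspace_iff, Matrix.mulVecLin_apply, Matrix.sub_mulVec,
    Matrix.smul_mulVec, Matrix.one_mulVec, sub_smul]
  constructor <;> intro h
  · rw [← h]; abel
  · rw [h]; abel

end LinearAlgebra

variable {V : Type*}

theorem vertexWeight_pos {ω : V → ℝ} (hω : ∀ v, 0 < ω v) (σ : Finset V) :
    0 < vertexWeight ω σ := Finset.prod_pos fun v _ => hω v

theorem sqrt_vertexWeight_ne_zero {ω : V → ℝ} (hω : ∀ v, 0 < ω v) (σ : Finset V) :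
    √(vertexWeight ω σ) ≠ 0 := (Real.sqrt_pos.mpr (vertexWeight_pos hω σ)).ne'

theorem mem_faces [Fintype V] {X : Complex V} {k : ℤ} {σ : Finset V} :
    σ ∈ faces X k ↔ σ ∈ X ∧ (σ.card : ℤ) = k + 1 := by
  simp [faces]

/-- The subsets of `V` with `k + 1` elements that are not faces of `X`. -/
noncomputable def nonfaces [Fintype V] (X : Complex V) (k : ℤ) : Finset (Finset V) :=
  open Classical in Finset.univ.filter fun σ => σ ∉ X ∧ (σ.card : ℤ) = k + 1

theorem mem_nonfaces [Fintype V] {X : Complex V} {k : ℤ} {σ : Finset V} :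
    σ ∈ nonfaces X k ↔ σ ∉ X ∧ (σ.card : ℤ) = k + 1 := by
  simp [nonfaces]

/-! ### Signs, creation operators and the full simplex -/

section Incidence

variable [LinearOrder V]

/-- The sign with which a vertex `v` is inserted into `τ`. -/
def insertSign (v : V) (τ : Finset V) : ℝ := (-1) ^ (τ.filter (· < v)).card

theorem insertSign_mul_self (v : V) (τ : Finset V) : insertSign v τ * insertSign v τ = 1 := by
  rw [insertSign, ← pow_add, Even.neg_one_pow ⟨_, rfl⟩]

/-- This is the source of anticommutation: for `u ≠ v`, exactly one of `u < v` and `v < u`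
contributes a sign. -/
theorem insertSign_insert {u v : V} {τ : Finset V} (hu : u ∉ τ) :
    insertSign v (insert u τ) = (if u < v then -1 else 1) * insertSign v τ := by
  unfold insertSign
  rw [Finset.filter_insert]
  split_ifs with h
  · rw [Finset.card_insert_of_notMem (by simp [hu]), pow_succ, mul_comm]
  · rw [one_mul]

theorem insertSign_insert_self (v : V) (τ : Finset V) :
    insertSign v (insert v τ) = insertSign v τ := by
  unfold insertSign
  rw [Finset.filter_insert, if_neg (lt_irrefl v)]

theorem incidence_insert {v : V} {τ : Finset V} (hv : v ∉ τ) :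
    incidence (insert v τ) τ = insertSign v τ := by
  rw [incidence, Finset.sum_eq_single_of_mem v (Finset.mem_insert_self v τ)]
  · rw [if_pos (Finset.erase_insert hv).symm]
    exact insertSign_insert_self v τ
  · intro u hu huv
    rw [if_neg]
    intro h
    have hmem := Finset.mem_erase.mpr ⟨Ne.symm huv, Finset.mem_insert_self v τ⟩
    rw [← h] at hmem
    exact hv hmem

theorem incidence_eq_zero {σ τ : Finset V} (h : ∀ v, v ∉ τ → σ ≠ insert v τ) :
    incidence σ τ = 0 := by
  refine Finset.sum_eq_zero fun v hv => if_neg ?_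
  rintro rfl
  exact h v (Finset.notMem_erase v σ) (Finset.insert_erase hv).symm

theorem exists_eq_insert_of_incidence_ne_zero {σ τ : Finset V} (h : incidence σ τ ≠ 0) :
    ∃ v, v ∉ τ ∧ σ = insert v τ := by
  by_contra hc
  push Not at hc
  exact h (incidence_eq_zero hc)

/-- The coefficients of the coboundary map of the full simplex in the orthonormal basis
`e_σ / √ω(σ)`. -/
noncomputable def normalizedIncidence (ω : V → ℝ) (σ τ : Finset V) : ℝ :=
  √(vertexWeight ω σ) / √(vertexWeight ω τ) * incidence σ τ

theorem card_eq_of_normalizedIncidence_ne_zero {ω : V → ℝ} {σ τ : Finset V}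
    (h : normalizedIncidence ω σ τ ≠ 0) : σ.card = τ.card + 1 ∧ τ ⊆ σ := by
  obtain ⟨v, hv, rfl⟩ := exists_eq_insert_of_incidence_ne_zero (right_ne_zero_of_mul h)
  exact ⟨Finset.card_insert_of_notMem hv, Finset.subset_insert v τ⟩

/-- The creation operator of the vertex `v`, scaled by `√ω(v)`. -/
noncomputable def creation (ω : V → ℝ) (v : V) (σ τ : Finset V) : ℝ :=
  if v ∉ τ ∧ σ = insert v τ then √(ω v) * insertSign v τ else 0

/-- At most one vertex leads from `τ` to `σ`, and multiplicativity of the weight reduces the ratio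
of square roots to `√(ω v)`. -/
theorem normalizedIncidence_eq_sum_creation [Fintype V] {ω : V → ℝ} (hω : ∀ v, 0 < ω v)
    (σ τ : Finset V) : normalizedIncidence ω σ τ = ∑ v, creation ω v σ τ := by
  by_cases h : ∃ v, v ∉ τ ∧ σ = insert v τ
  · obtain ⟨v, hv, rfl⟩ := h
    rw [Finset.sum_eq_single_of_mem v (Finset.mem_univ v), creation, if_pos ⟨hv, rfl⟩,
      normalizedIncidence, incidence_insert hv, vertexWeight, Finset.prod_insert hv,
      Real.sqrt_mul (hω v).le]
    · congr 1
      exact mul_div_cancel_right₀ _ (sqrt_vertexWeight_ne_zero hω τ)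
    · rintro u - huv
      refine if_neg ?_
      rintro ⟨hu, h⟩
      have := h ▸ Finset.mem_insert_self v τ
      rcases Finset.mem_insert.mp this with h' | h'
      · exact huv h'.symm
      · exact hv h'
  · push Not at h
    rw [normalizedIncidence, incidence_eq_zero h, mul_zero]
    refine (Finset.sum_eq_zero fun v _ => if_neg ?_).symm
    rintro ⟨hv, h'⟩
    exact h v hv h'

/-- The canonical anticommutation relations. -/
theorem creation_anticommutator [Fintype V] {ω : V → ℝ} (hω : ∀ v, 0 < ω v) (u v : V)
    (σ ρ : Finset V) :
    ∑ τ, creation ω u τ σ * creation ω v τ ρ + ∑ τ, creation ω v σ τ * creation ω u ρ τ =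
      if u = v ∧ σ = ρ then ω u else 0 := by
  have hup : ∑ τ, creation ω u τ σ * creation ω v τ ρ =
      creation ω u (insert u σ) σ * creation ω v (insert u σ) ρ := by
    refine Finset.sum_eq_single_of_mem _ (Finset.mem_univ _) fun τ _ hτ => ?_
    rw [creation, if_neg (fun h => hτ h.2), zero_mul]
  have hdown : ∑ τ, creation ω v σ τ * creation ω u ρ τ =
      creation ω v σ (σ.erase v) * creation ω u ρ (σ.erase v) := by
    refine Finset.sum_eq_single_of_mem _ (Finset.mem_univ _) fun τ _ hτ => ?_
    rw [creation, if_neg, zero_mul]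
    rintro ⟨h, rfl⟩
    exact hτ (Finset.erase_insert h).symm
  rw [hup, hdown]
  by_cases huv : u = v
  · subst huv
    have hsq : √(ω u) * √(ω u) = ω u := Real.mul_self_sqrt (hω u).le
    by_cases hu : u ∈ σ
    · rw [creation, if_neg (by simp [hu]), zero_mul, zero_add, creation,
        if_pos ⟨Finset.notMem_erase u σ, (Finset.insert_erase hu).symm⟩, creation,
        Finset.insert_erase hu]
      by_cases hσ : σ = ρ
      · rw [if_pos ⟨Finset.notMem_erase u σ, hσ.symm⟩, if_pos ⟨rfl, hσ⟩, mul_mul_mul_comm, hsq,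
          insertSign_mul_self, mul_one]
      · rw [if_neg (fun h => hσ h.2.symm), if_neg (fun h => hσ h.2), mul_zero]
    · have h0 : creation ω u σ (σ.erase u) = 0 :=
        if_neg fun h => hu (by rw [h.2]; exact Finset.mem_insert_self _ _)
      rw [h0, zero_mul, add_zero, creation, if_pos ⟨hu, rfl⟩, creation]
      by_cases hσ : σ = ρ
      · subst hσ
        rw [if_pos ⟨hu, rfl⟩, if_pos ⟨rfl, rfl⟩, mul_mul_mul_comm, hsq,
          insertSign_mul_self, mul_one]
      · rw [if_neg, if_neg (fun h => hσ h.2), mul_zero]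
        rintro ⟨hρ, h⟩
        exact hσ (by rw [← Finset.erase_insert hu, h, Finset.erase_insert hρ])
  · rw [if_neg fun h => huv h.1]
    -- For `u ≠ v`, either product can be nonzero only when `σ` and `ρ` arise from a common `α` by
    -- adding `v` and `u` respectively.
    by_cases h : ∃ α : Finset V, u ∉ α ∧ v ∉ α ∧ σ = insert v α ∧ ρ = insert u α
    · obtain ⟨α, hu, hv, rfl, rfl⟩ := h
      have hu' : u ∉ insert v α := by simp [huv, hu]
      have hv' : v ∉ insert u α := by simp [Ne.symm huv, hv]
      rw [Finset.erase_insert hv]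
      unfold creation
      rw [if_pos ⟨hu', rfl⟩, if_pos ⟨hv', Finset.insert_comm u v α⟩, if_pos ⟨hv, rfl⟩,
        if_pos ⟨hu, rfl⟩, insertSign_insert hu, insertSign_insert hv]
      rcases lt_or_gt_of_ne huv with h | h
      · rw [if_pos h, if_neg h.not_gt]; ring
      · rw [if_pos h, if_neg h.not_gt]; ring
    · have h1 : creation ω u (insert u σ) σ * creation ω v (insert u σ) ρ = 0 := by
        by_contra hne
        have ha := left_ne_zero_of_mul hne
        have hb := right_ne_zero_of_mul hne
        unfold creation at ha hb
        have ha' := (ite_ne_right_iff.mp ha).1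
        have hb' := (ite_ne_right_iff.mp hb).1
        refine h ⟨σ.erase v, fun hc => ha'.1 (Finset.mem_of_mem_erase hc),
          Finset.notMem_erase v σ, ?_, ?_⟩
        · refine (Finset.insert_erase ?_).symm
          have : v ∈ insert u σ := hb'.2 ▸ Finset.mem_insert_self v ρ
          exact (Finset.mem_insert.mp this).resolve_left (Ne.symm huv)
        · rw [← Finset.erase_insert_of_ne huv, hb'.2, Finset.erase_insert hb'.1]
      have h2 : creation ω v σ (σ.erase v) * creation ω u ρ (σ.erase v) = 0 := by
        by_contra hne
        have ha := left_ne_zero_of_mul hne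
        have hb := right_ne_zero_of_mul hne
        unfold creation at ha hb
        have ha' := (ite_ne_right_iff.mp ha).1
        have hb' := (ite_ne_right_iff.mp hb).1
        exact h ⟨σ.erase v, hb'.1, ha'.1, ha'.2, hb'.2⟩
      rw [h1, h2, add_zero]

/-- The weighted Laplacian of the full simplex is the scalar `∑ v, ω v`. -/
theorem sum_normalizedIncidence_mul [Fintype V] {ω : V → ℝ} (hω : ∀ v, 0 < ω v)
    (σ ρ : Finset V) :
    ∑ τ, normalizedIncidence ω τ σ * normalizedIncidence ω τ ρ +
        ∑ τ, normalizedIncidence ω σ τ * normalizedIncidence ω ρ τ =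
      if σ = ρ then ∑ v, ω v else 0 := by
  have hup : ∑ τ, normalizedIncidence ω τ σ * normalizedIncidence ω τ ρ =
      ∑ u, ∑ v, ∑ τ, creation ω u τ σ * creation ω v τ ρ := by
    simp only [normalizedIncidence_eq_sum_creation hω, Finset.sum_mul_sum]
    rw [Finset.sum_comm]
    exact Finset.sum_congr rfl fun u _ => Finset.sum_comm
  -- The two vertex indices are named in the order that makes each term pair with one of `hup` in
  -- the anticommutator.
  have hdown : ∑ τ, normalizedIncidence ω σ τ * normalizedIncidence ω ρ τ =
      ∑ u, ∑ v, ∑ τ, creation ω v σ τ * creation ω u ρ τ := by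
    simp only [normalizedIncidence_eq_sum_creation hω, Finset.sum_mul_sum]
    rw [Finset.sum_comm, Finset.sum_comm' (t' := Finset.univ) (s' := fun _ => Finset.univ)
      (by simp)]
    rw [Finset.sum_comm]
    refine (Finset.sum_congr rfl fun u _ => Finset.sum_comm).trans ?_
    exact Finset.sum_comm
  rw [hup, hdown, ← Finset.sum_add_distrib]
  simp only [← Finset.sum_add_distrib, creation_anticommutator hω]
  split_ifs with h <;> simp [h]

end Incidence

/-! ### The Laplacian as a scalar minus a Gram matrix -/

section Laplacian

variable [Fintype V] [LinearOrder V]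

/-- The part of the coboundary map of the full simplex that leads from the `k`-cochains of `X` to
cochains supported outside `X`, in orthonormal bases. -/
noncomputable def exitMatrix (ω : V → ℝ) (X : Complex V) (k : ℤ) :
    Matrix (nonfaces X (k + 1)) (faces X k) ℝ :=
  Matrix.of fun σ τ => normalizedIncidence ω σ.1 τ.1

theorem sum_faces_add_sum_nonfaces (ω : V → ℝ) (X : Complex V) {k : ℤ} {σ : Finset V}
    (hσ : (σ.card : ℤ) = k + 1) (g : Finset V → ℝ) :
    ∑ τ : faces X (k + 1), normalizedIncidence ω τ.1 σ * g τ.1 +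
        ∑ τ : nonfaces X (k + 1), normalizedIncidence ω τ.1 σ * g τ.1 =
      ∑ τ, normalizedIncidence ω τ σ * g τ := by
  rw [Finset.sum_coe_sort (faces X (k + 1)) fun τ => normalizedIncidence ω τ σ * g τ,
    Finset.sum_coe_sort (nonfaces X (k + 1)) fun τ => normalizedIncidence ω τ σ * g τ,
    ← Finset.sum_union]
  · refine Finset.sum_subset (Finset.subset_univ _) fun τ _ hτ => ?_
    by_contra hne
    have hc := (card_eq_of_normalizedIncidence_ne_zero (left_ne_zero_of_mul hne)).1
    have hc' : (τ.card : ℤ) = k + 1 + 1 := by omega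
    refine hτ (Finset.mem_union.mpr ?_)
    by_cases h : τ ∈ X
    · exact Or.inl (mem_faces.mpr ⟨h, hc'⟩)
    · exact Or.inr (mem_nonfaces.mpr ⟨h, hc'⟩)
  · exact Finset.disjoint_left.mpr fun τ h1 h2 => (mem_nonfaces.mp h2).1 (mem_faces.mp h1).1

/-- Downward closure makes every facet of a face a face, so the down part has no missing terms. -/
theorem sum_faces_pred (ω : V → ℝ) (X : Complex V) {k : ℤ} {σ : Finset V}
    (hσ : σ ∈ faces X k) (g : Finset V → ℝ) :
    ∑ τ : faces X (k - 1), normalizedIncidence ω σ τ.1 * g τ.1 =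
      ∑ τ, normalizedIncidence ω σ τ * g τ := by
  rw [Finset.sum_coe_sort (faces X (k - 1)) fun τ => normalizedIncidence ω σ τ * g τ]
  refine Finset.sum_subset (Finset.subset_univ _) fun τ _ hτ => ?_
  by_contra hne
  obtain ⟨hc, hsub⟩ := card_eq_of_normalizedIncidence_ne_zero (left_ne_zero_of_mul hne)
  obtain ⟨hX, hk⟩ := mem_faces.mp hσ
  exact hτ (mem_faces.mpr ⟨X.lower hsub hX, by omega⟩)

/-- The matrix of the weighted Laplacian in the basis of elementary cochains. -/
noncomputable def laplacianMatrix (ω : V → ℝ) (X : Complex V) (k : ℤ) :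
    Matrix (faces X k) (faces X k) ℝ :=
  Matrix.of fun σ ρ =>
    ∑ τ : faces X (k + 1), vertexWeight ω τ.1 / vertexWeight ω σ.1 * incidence τ.1 σ.1 *
        incidence τ.1 ρ.1 +
      ∑ τ : faces X (k - 1), incidence σ.1 τ.1 *
        (vertexWeight ω ρ.1 / vertexWeight ω τ.1 * incidence ρ.1 τ.1)

theorem laplacian_eq_mulVecLin (ω : V → ℝ) (X : Complex V) (k : ℤ) :
    laplacian (vertexWeight ω) X k = (laplacianMatrix ω X k).mulVecLin := by
  simp only [laplacian, coboundary, coboundaryAdjoint]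
  rw [← Matrix.mulVecLin_mul, ← Matrix.mulVecLin_mul, ← Matrix.mulVecLin_add]
  rfl

/-- Conjugating by `√ω(σ)` symmetrizes the matrix; the terms missing from the full simplex identity
are then those of the Gram matrix. -/
theorem sqrt_mul_laplacianMatrix {ω : V → ℝ} (hω : ∀ v, 0 < ω v) (X : Complex V) (k : ℤ)
    (σ ρ : faces X k) :
    √(vertexWeight ω σ.1) * laplacianMatrix ω X k σ ρ =
      ((∑ v, ω v) • (1 : Matrix (faces X k) (faces X k) ℝ) -
        (exitMatrix ω X k).transpose * exitMatrix ω X k) σ ρ * √(vertexWeight ω ρ.1) := by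
  have hs := sqrt_vertexWeight_ne_zero hω
  have hw (α : Finset V) : vertexWeight ω α = √(vertexWeight ω α) * √(vertexWeight ω α) :=
    (Real.mul_self_sqrt (vertexWeight_pos hω α).le).symm
  have hL : √(vertexWeight ω σ.1) * laplacianMatrix ω X k σ ρ =
      (∑ τ : faces X (k + 1), normalizedIncidence ω τ.1 σ.1 * normalizedIncidence ω τ.1 ρ.1 +
        ∑ τ : faces X (k - 1), normalizedIncidence ω σ.1 τ.1 * normalizedIncidence ω ρ.1 τ.1) *
          √(vertexWeight ω ρ.1) := by
    rw [laplacianMatrix, Matrix.of_apply, mul_add, add_mul, Finset.mul_sum, Finset.mul_sum,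
      Finset.sum_mul, Finset.sum_mul]
    congr 1 <;> refine Finset.sum_congr rfl fun τ _ => ?_
    · have h1 := hs σ.1
      have h2 := hs ρ.1
      rw [hw τ.1, hw σ.1, Real.sqrt_mul_self (Real.sqrt_nonneg _), normalizedIncidence,
        normalizedIncidence]
      field_simp
    · have h1 := hs τ.1
      rw [hw τ.1, hw ρ.1, Real.sqrt_mul_self (Real.sqrt_nonneg _), normalizedIncidence,
        normalizedIncidence]
      field_simp
  have hM : ((exitMatrix ω X k).transpose * exitMatrix ω X k) σ ρ =
      ∑ τ : nonfaces X (k + 1), normalizedIncidence ω τ.1 σ.1 * normalizedIncidence ω τ.1 ρ.1 :=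
    rfl
  have h1 := sum_faces_add_sum_nonfaces ω X (mem_faces.mp σ.2).2
    fun τ => normalizedIncidence ω τ ρ.1
  have h2 := sum_faces_pred ω X σ.2 fun τ => normalizedIncidence ω ρ.1 τ
  have h3 := sum_normalizedIncidence_mul hω σ.1 ρ.1
  rw [hL, Matrix.sub_apply, Matrix.smul_apply, Matrix.one_apply, hM]
  simp only [Subtype.ext_iff, smul_eq_mul, mul_ite, mul_one, mul_zero]
  congr 1
  linarith

/-- The Laplacian of `X` is conjugate to `∑ v, ω v` minus the Gram matrix of `exitMatrix`. -/
theorem multiplicity_eq_finrank_gram {ω : V → ℝ} (hω : ∀ v, 0 < ω v) (X : Complex V) (k : ℤ)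
    (t : ℝ) :
    multiplicity ω X k t = finrank ℝ (End.eigenspace
      ((exitMatrix ω X k).transpose * exitMatrix ω X k).mulVecLin (∑ v, ω v - t)) := by
  rw [multiplicity, laplacian_eq_mulVecLin, ← eigenspace_mulVecLin_scalar_sub]
  exact finrank_eigenspace_mulVecLin_congr _ _ (Equiv.refl _) (fun σ => √(vertexWeight ω σ.1))
    (fun σ => sqrt_vertexWeight_ne_zero hω σ.1) (sqrt_mul_laplacianMatrix hω X k) t

end Laplacian

/-! ### Complementation and the transposed exit matrix -/

section AlexanderDual

variable [Fintype V] [LinearOrder V]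

/-- The parity of the sum of the positions of the vertices of `σ` in `V`. -/
def positionSign (σ : Finset V) : ℝ := ∏ v ∈ σ, insertSign v Finset.univ

theorem positionSign_mul_self (σ : Finset V) : positionSign σ * positionSign σ = 1 := by
  rw [positionSign, ← Finset.prod_mul_distrib]
  exact Finset.prod_eq_one fun v _ => insertSign_mul_self v _

theorem insertSign_mul_insertSign_compl (v : V) (τ : Finset V) :
    insertSign v τ * insertSign v τᶜ = insertSign v Finset.univ := by
  unfold insertSign
  rw [← pow_add, ← Finset.card_union_of_disjoint, ← Finset.filter_union,
    Finset.union_compl]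
  exact Finset.disjoint_filter_filter disjoint_compl_right

/-- The vertices of `V` below `v` split between `τ` and its complement, so the two insertion signs
multiply to the position sign of `v`, the quotient of the position signs of `insert v τ` and `τ`. -/
theorem incidence_compl (σ τ : Finset V) :
    incidence τᶜ σᶜ = positionSign σ * positionSign τ * incidence σ τ := by
  by_cases h : ∃ v, v ∉ τ ∧ σ = insert v τ
  · obtain ⟨v, hv, rfl⟩ := h
    have hv' : v ∉ (insert v τ)ᶜ := by simp
    have hc : τᶜ = insert v (insert v τ)ᶜ := by
      ext x
      by_cases hx : x = v <;> simp [hx, hv]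
    have hs : insertSign v τᶜ = insertSign v (insert v τ)ᶜ := by
      rw [hc, insertSign_insert_self]
    rw [incidence_insert hv, hc, incidence_insert hv', ← hs]
    have h1 := insertSign_mul_insertSign_compl v τ
    have h2 := insertSign_mul_self v τ
    have h3 := positionSign_mul_self τ
    have h4 : positionSign (insert v τ) = insertSign v Finset.univ * positionSign τ :=
      Finset.prod_insert hv
    rw [h4, ← h1]
    linear_combination (-insertSign v τᶜ) * h2 -
      insertSign v τ * insertSign v τᶜ * insertSign v τ * h3
  · push Not at h
    rw [incidence_eq_zero h, mul_zero]
    refine incidence_eq_zero fun v hv hc => ?_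
    rw [Finset.mem_compl, not_not] at hv
    have hτ : v ∉ τ := by
      rw [← Finset.mem_compl, hc]
      exact Finset.mem_insert_self _ _
    refine h v hτ ?_
    rw [← compl_inj_iff, Finset.compl_insert, hc, Finset.erase_insert (by simpa using hv)]

theorem normalizedIncidence_compl {ω : V → ℝ} (hω : ∀ v, 0 < ω v) (σ τ : Finset V) :
    normalizedIncidence ω τᶜ σᶜ =
      positionSign σ * positionSign τ * normalizedIncidence ω σ τ := by
  have hmul (α : Finset V) : √(vertexWeight ω α) * √(vertexWeight ω αᶜ) = √(∏ v, ω v) := by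
    rw [← Real.sqrt_mul (vertexWeight_pos hω α).le]
    exact congrArg _ (Finset.prod_mul_prod_compl α ω)
  have hs := sqrt_vertexWeight_ne_zero hω
  -- For product weights, `ω(α) ω(αᶜ)` does not depend on `α`.
  have hq : √(vertexWeight ω τᶜ) / √(vertexWeight ω σᶜ) =
      √(vertexWeight ω σ) / √(vertexWeight ω τ) := by
    rw [div_eq_div_iff (hs _) (hs _), hmul, mul_comm, hmul]
  rw [normalizedIncidence, normalizedIncidence, hq, incidence_compl]
  ring

/-- A (k+1)-simplex has k + 2 vertices, so its complement has n - k - 2 and dimension n - k - 3. -/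
theorem compl_mem_faces_alexanderDual {X : Complex V} {k : ℤ} {σ : Finset V} :
    σᶜ ∈ faces (alexanderDual X) ((Fintype.card V : ℤ) - k - 3) ↔ σ ∈ nonfaces X (k + 1) := by
  have hmem : σᶜ ∈ alexanderDual X ↔ σᶜᶜ ∉ X := Iff.rfl
  rw [mem_faces, mem_nonfaces, hmem, compl_compl]
  have := Finset.card_add_card_compl σ
  refine and_congr_right fun _ => ?_
  omega

theorem compl_mem_nonfaces_alexanderDual {X : Complex V} {k : ℤ} {σ : Finset V} :
    σᶜ ∈ nonfaces (alexanderDual X) ((Fintype.card V : ℤ) - k - 3 + 1) ↔ σ ∈ faces X k := by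
  have hmem : σᶜ ∈ alexanderDual X ↔ σᶜᶜ ∉ X := Iff.rfl
  rw [mem_faces, mem_nonfaces, hmem, compl_compl, not_not]
  have := Finset.card_add_card_compl σ
  refine and_congr_right fun _ => ?_
  omega

/-- Taking complements, as a bijection between two families of subsets of `V`. -/
def complEquiv {S T : Finset (Finset V)} (h : ∀ σ, σᶜ ∈ T ↔ σ ∈ S) : S ≃ T where
  toFun σ := ⟨σ.1ᶜ, (h σ.1).mpr σ.2⟩
  invFun τ := ⟨τ.1ᶜ, (h _).mp (by rw [compl_compl]; exact τ.2)⟩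
  left_inv σ := Subtype.ext (compl_compl σ.1)
  right_inv τ := Subtype.ext (compl_compl τ.1)

/-- The Laplacian of the Alexander dual is governed by the transposed Gram matrix. -/
theorem multiplicity_alexanderDual_eq_finrank_gram {ω : V → ℝ} (hω : ∀ v, 0 < ω v)
    (X : Complex V) (k : ℤ) (t : ℝ) :
    multiplicity ω (alexanderDual X) ((Fintype.card V : ℤ) - k - 3) t =
      finrank ℝ (End.eigenspace
        (exitMatrix ω X k * (exitMatrix ω X k).transpose).mulVecLin (∑ v, ω v - t)) := by
  rw [multiplicity_eq_finrank_gram hω]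
  refine finrank_eigenspace_mulVecLin_congr _ _
    (complEquiv fun σ => compl_mem_faces_alexanderDual) (fun σ => positionSign σ.1)
    (fun σ => left_ne_zero_of_mul_eq_one (positionSign_mul_self σ.1)) (fun σ ρ => ?_) _
  have hσ := positionSign_mul_self σ.1
  simp only [Matrix.mul_apply, Matrix.transpose_apply, Finset.mul_sum, Finset.sum_mul]
  rw [← (complEquiv (S := faces X k) fun σ => compl_mem_nonfaces_alexanderDual).sum_comp]
  refine Finset.sum_congr rfl fun τ _ => ?_
  have hτ := positionSign_mul_self τ.1
  have h1 := normalizedIncidence_compl hω σ.1 τ.1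
  have h2 := normalizedIncidence_compl hω ρ.1 τ.1
  change positionSign σ.1 * (normalizedIncidence ω τ.1ᶜ σ.1ᶜ * normalizedIncidence ω τ.1ᶜ ρ.1ᶜ) =
    normalizedIncidence ω σ.1 τ.1 * normalizedIncidence ω ρ.1 τ.1 * positionSign ρ.1
  rw [h1, h2]
  set a := normalizedIncidence ω σ.1 τ.1 * normalizedIncidence ω ρ.1 τ.1 * positionSign ρ.1
  -- The sign of `τ` occurs twice and cancels; those of `σ` and `ρ` are absorbed by the diagonal
  -- conjugation.
  linear_combination (norm := skip) (positionSign τ.1 * positionSign τ.1 * a) * hσ + a * hτ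
  simp only [a]
  ring

theorem card_faces_add_card_nonfaces (X : Complex V) {k : ℤ} (hk : -1 ≤ k) :
    (faces X k).card + (nonfaces X k).card = (Fintype.card V).choose (k + 1).toNat := by
  rw [← Finset.card_univ, ← Finset.card_powersetCard, ← Finset.card_union_of_disjoint]
  · congr 1
    ext σ
    rw [Finset.mem_union, mem_faces, mem_nonfaces, ← or_and_right, Finset.mem_powersetCard,
      and_iff_right (em _), and_iff_right (Finset.subset_univ σ)]
    omega
  · exact Finset.disjoint_left.mpr fun τ h1 h2 => (mem_nonfaces.mp h2).1 (mem_faces.mp h1).1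

end AlexanderDual

end WeightedComplex

theorem theorem3p11 {V : Type*} [Fintype V] [LinearOrder V]
    (X : WeightedComplex.Complex V) (ω : V → ℝ) (hω : ∀ v, 0 < ω v)
    (k : ℤ) (hk : -1 ≤ k) (hkn : k ≤ (Fintype.card V : ℤ) - 2) :
    (∀ t : ℝ, t < ∑ v, ω v →
      WeightedComplex.multiplicity ω X k t =
        WeightedComplex.multiplicity ω (WeightedComplex.alexanderDual X)
          ((Fintype.card V : ℤ) - k - 3) t) ∧
    (WeightedComplex.multiplicity ω X k (∑ v, ω v) : ℤ) -
        (WeightedComplex.multiplicity ω (WeightedComplex.alexanderDual X)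
          ((Fintype.card V : ℤ) - k - 3) (∑ v, ω v) : ℤ) =
      (WeightedComplex.fNum X k : ℤ) + (WeightedComplex.fNum X (k + 1) : ℤ) -
        ((Fintype.card V).choose (k + 2).toNat : ℤ) := by
  open WeightedComplex in
  refine ⟨fun t ht => ?_, ?_⟩
  · rw [multiplicity_eq_finrank_gram hω, multiplicity_alexanderDual_eq_finrank_gram hω,
      Matrix.mulVecLin_mul, Matrix.mulVecLin_mul]
    -- The Gram eigenvalue is `∑ v, ω v - t`, nonzero exactly because `t` lies below the sum.
    exact finrank_eigenspace_comp_comm _ _ (sub_pos.mpr ht).ne'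
  · rw [multiplicity_eq_finrank_gram hω, multiplicity_alexanderDual_eq_finrank_gram hω, sub_self]
    have h1 := finrank_eigenspace_zero_gram (exitMatrix ω X k)
    -- Turns the row count of the exit matrix into a binomial coefficient minus the number of
    -- (k+1)-faces.
    have h2 := card_faces_add_card_nonfaces X (k := k + 1) (by omega)
    rw [Fintype.card_coe, Fintype.card_coe] at h1
    rw [show k + 1 + 1 = k + 2 by ring] at h2
    unfold fNum
    omega
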